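/- Let $K$ be a field of characteristic $0$, let $P=K\langle x_1,x_2,x_3\rangle$ be the free $K$-ring on three noncommuting indeterminates, and put $\sigma_1=x_1+x_2+x_3$, $\sigma_2=x_1x_2+x_1x_3+x_2x_3$, $\sigma_3=x_1x_2x_3$. Let $R'=P/I$, where $I$ is the two-sided ideal generated by all $x_i\sigma_k-\sigma_kx_i$ ($1\le i,k\le 3$), and let $R$ be the ring of fractions $r/\lambda$ with $r\in R'$ and $0\ne\lambda\in K[\sigma_1,\sigma_2,\sigma_3]$; it contains the field $W=K(\sigma_1,\sigma_2,\sigma_3)$ in its center. The group $G=\langle(1\,2\,3)\rangle$ acts on $R$ by circularly permuting the indices of the $x_i$, fixing $W$ pointwise; write $\overline p=\sum_{g\in G}p^g$ for $p\in R$, and let $S=\{p\in R: p^g=p \text{ for all } g\in G\}$. Let $c=x_1x_2-x_2x_1$ $(=x_2x_3-x_3x_2=x_3x_1-x_1x_3)$ and let $Z=W[c^3,\overline{x_1x_2x_1}]$ be the subring of $R$ generated by $W$, $c^3$ and $\overline{x_1x_2x_1}$. Theorem 3.4. Every $p\in S$ has the form $z_0+z_1c+z_2c^2$ with $z_0,z_1,z_2\in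 Z$. Accordingly: (i) $S$ is a commutative degree $3$ extension of $Z$; that is, $S$ is a commutative ring containing $Z$ and $c$, and $1,c,c^2$ are linearly independent over $Z$ (so they form a basis of $S$ as a $Z$-module). (ii) For every $p\in R$, $\overline p$ is either central in $R$ or is a root of a monic cubic polynomial with coefficients in $Z$. -/

import Mathlib

/-! The ring generated by three noncommuting indeterminates subject to the centrality of their
elementary polynomials, its localization at the nonzero polynomials in the elementary
polynomials, and the action of the circular permutations of the indeterminates.
The indeterminates are numbered `0, 1, 2 : Fin 3`. -/

namespace NCElementary

/-- The elementary polynomials `σ₁, σ₂, σ₃` (numbered `0, 1, 2`) of three elements of a ring, with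
the factors of each monomial in increasing order. -/
def elem {A : Type*} [Ring A] (v : Fin 3 → A) : Fin 3 → A :=
  ![v 0 + v 1 + v 2, v 0 * v 1 + v 0 * v 2 + v 1 * v 2, v 0 * v 1 * v 2]

theorem map_elem {A B : Type*} [Ring A] [Ring B] (f : A →+* B) (v : Fin 3 → A) (k : Fin 3) :
    f (elem v k) = elem (fun i => f (v i)) k := by
  fin_cases k <;> simp [elem]

/-- If each elementary polynomial of `v` commutes with each `v i`, then the elementary polynomials
are unchanged by the circular permutation of the `v i`. -/
theorem elem_rotate {A : Type*} [Ring A] (v : Fin 3 → A)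
    (h : ∀ i k, v i * elem v k = elem v k * v i) (k : Fin 3) :
    elem (fun i => v (i + 1)) k = elem v k := by
  have h0 : v 0 * (v 1 + v 2) = (v 1 + v 2) * v 0 := by
    have := h 0 0
    simp only [elem, Matrix.cons_val_zero] at this
    rw [add_assoc, mul_add, add_mul] at this
    exact add_left_cancel this
  have h1 : v 0 * (v 1 * v 2) = v 1 * v 2 * v 0 := by
    have := h 0 1
    simp only [elem, Matrix.cons_val_one, Matrix.cons_val_zero] at this
    have e : v 0 * v 1 + v 0 * v 2 + v 1 * v 2 = v 0 * (v 1 + v 2) + v 1 * v 2 := by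
      noncomm_ring
    rw [e, mul_add, add_mul, mul_assoc (v 0) (v 1 + v 2) (v 0), ← h0] at this
    exact add_left_cancel this
  fin_cases k
  · simp [elem]; abel
  · simp only [elem]
    have : v 0 * v 1 + v 0 * v 2 = v 1 * v 0 + v 2 * v 0 := by
      rw [← mul_add, ← add_mul, h0]
    simp only [Fin.mk_one, Matrix.cons_val_one, Matrix.cons_val_zero, Fin.isValue, zero_add,
      Fin.reduceAdd]
    rw [this]; abel
  · simp only [elem]
    simp [mul_assoc, h1]

variable (K : Type*) [Field K]

/-- The relations `xᵢ σₖ = σₖ xᵢ` in the free `K`-ring on three noncommuting indeterminates. -/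
inductive Rel : FreeAlgebra K (Fin 3) → FreeAlgebra K (Fin 3) → Prop
  | comm (i k : Fin 3) :
      Rel (FreeAlgebra.ι K i * elem (FreeAlgebra.ι K) k) (elem (FreeAlgebra.ι K) k * FreeAlgebra.ι K i)

/-- The ring `R'`: the free ring modulo the two-sided ideal generated by all `xᵢ σₖ - σₖ xᵢ`. -/
abbrev R' : Type _ := RingQuot (Rel K)

/-- The indeterminates in `R'`. -/
noncomputable def x' (i : Fin 3) : R' K := RingQuot.mkAlgHom K (Rel K) (FreeAlgebra.ι K i)

/-- The elementary polynomials in `R'`. -/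
noncomputable def sigma' (k : Fin 3) : R' K := elem (x' K) k

theorem x'_comm (i k : Fin 3) : x' K i * sigma' K k = sigma' K k * x' K i := by
  have h := RingQuot.mkAlgHom_rel K (Rel.comm (K := K) i k)
  have e : RingQuot.mkAlgHom K (Rel K) (elem (FreeAlgebra.ι K) k) = sigma' K k :=
    map_elem (RingQuot.mkAlgHom K (Rel K)).toRingHom _ k
  rw [map_mul, map_mul, e] at h
  exact h

/-- The algebra homomorphism out of `R'` given by three elements whose elementary polynomials
commute with them. -/
noncomputable def lift' {A : Type*} [Ring A] [Algebra K A] (v : Fin 3 → A)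
    (h : ∀ i k, v i * elem v k = elem v k * v i) : R' K →ₐ[K] A :=
  RingQuot.liftAlgHom K ⟨FreeAlgebra.lift K v, by
    rintro _ _ ⟨i, k⟩
    have e : FreeAlgebra.lift K v (elem (FreeAlgebra.ι K) k) = elem v k := by
      refine (map_elem (FreeAlgebra.lift K v).toRingHom _ k).trans ?_
      congr 1
      funext j
      exact FreeAlgebra.lift_ι_apply v j
    rw [map_mul, map_mul, e, FreeAlgebra.lift_ι_apply, h]⟩

@[simp] theorem lift'_x' {A : Type*} [Ring A] [Algebra K A] (v : Fin 3 → A)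
    (h : ∀ i k, v i * elem v k = elem v k * v i) (i : Fin 3) : lift' K v h (x' K i) = v i := by
  simp [lift', x']

theorem lift'_sigma' {A : Type*} [Ring A] [Algebra K A] (v : Fin 3 → A)
    (h : ∀ i k, v i * elem v k = elem v k * v i) (k : Fin 3) :
    lift' K v h (sigma' K k) = elem v k := by
  refine (map_elem (lift' K v h).toRingHom _ k).trans ?_
  congr 1
  funext j
  exact lift'_x' K v h j

variable {K} in
theorem R'_induction {C : R' K → Prop} (hK : ∀ a, C (algebraMap K _ a)) (hx : ∀ i, C (x' K i))
    (hm : ∀ a b, C a → C b → C (a * b)) (ha : ∀ a b, C a → C b → C (a + b)) (r : R' K) : C r := by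
  obtain ⟨p, rfl⟩ := RingQuot.mkAlgHom_surjective K (Rel K) r
  induction p using FreeAlgebra.induction with
  | grade0 a => simpa using hK a
  | grade1 i => exact hx i
  | mul a b h1 h2 => simpa using hm _ _ h1 h2
  | add a b h1 h2 => simpa using ha _ _ h1 h2

theorem sigma'_central (k : Fin 3) : sigma' K k ∈ Subalgebra.center K (R' K) := by
  rw [Subalgebra.mem_center_iff]
  intro r
  induction r using R'_induction with
  | hK a => exact Algebra.commutes a _
  | hx i => exact x'_comm K i k
  | hm a b h1 h2 => rw [mul_assoc, h2, ← mul_assoc, h1, mul_assoc]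
  | ha a b h1 h2 => rw [add_mul, mul_add, h1, h2]

/-- The subring `K[σ₁, σ₂, σ₃]` of `R'`. -/
noncomputable def W' : Subalgebra K (R' K) := Algebra.adjoin K (Set.range (sigma' K))

theorem W'_central {w : R' K} (hw : w ∈ W' K) (r : R' K) : r * w = w * r := by
  have : W' K ≤ Subalgebra.center K (R' K) := by
    refine Algebra.adjoin_le ?_
    rintro _ ⟨k, rfl⟩
    exact sigma'_central K k
  exact Subalgebra.mem_center_iff.1 (this hw) r

/-- Polynomials in the elementary polynomials, as elements of `R'`. -/
noncomputable def polyMap : MvPolynomial (Fin 3) K →ₐ[K] R' K :=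
  (Subalgebra.center K (R' K)).val.comp
    (MvPolynomial.aeval fun k => ⟨sigma' K k, sigma'_central K k⟩)

theorem polyMap_X (k : Fin 3) : polyMap K (MvPolynomial.X k) = sigma' K k := by
  simp [polyMap]

theorem W'_eq_range : W' K = (polyMap K).range := by
  rw [← Algebra.map_top, ← MvPolynomial.adjoin_range_X, AlgHom.map_adjoin, ← Set.range_comp, W']
  congr 2
  funext k
  exact (polyMap_X K k).symm

/-- The elementary polynomials are algebraically independent: they stay so when the
indeterminates are allowed to commute. -/
theorem polyMap_injective : Function.Injective (polyMap K) := by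
  let ψ : R' K →ₐ[K] MvPolynomial (Fin 3) K := lift' K MvPolynomial.X fun _ _ => mul_comm _ _
  have key : ψ.comp (polyMap K) =
      (MvPolynomial.symmetricSubalgebra (Fin 3) K).val.comp
        (MvPolynomial.esymmAlgHom (Fin 3) K 3) := by
    refine MvPolynomial.algHom_ext fun k => ?_
    have e : ψ (sigma' K k) = elem MvPolynomial.X k := lift'_sigma' K _ _ k
    rw [AlgHom.comp_apply, polyMap_X, e]
    simp only [AlgHom.comp_apply, MvPolynomial.esymmAlgHom_apply, Subalgebra.coe_val,
      MvPolynomial.aeval_X]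
    fin_cases k
    · simp [elem, MvPolynomial.esymm_one, Fin.sum_univ_three]
    · have : Finset.powersetCard 2 (Finset.univ : Finset (Fin 3)) = {{0, 1}, {0, 2}, {1, 2}} := by
        decide
      simp [elem, MvPolynomial.esymm, this, add_assoc]
      rw [Finset.sum_insert (by decide), Finset.sum_insert (by decide)]
      simp
    · have : Finset.powersetCard 3 (Finset.univ : Finset (Fin 3)) = {Finset.univ} := by
        decide
      simp [elem, MvPolynomial.esymm, this, Fin.prod_univ_three]
  have hinj : Function.Injective (ψ.comp (polyMap K)) := by
    rw [key]
    exact Subtype.val_injective.comp (MvPolynomial.esymmAlgHom_injective K (by simp))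
  exact Function.Injective.of_comp (f := ψ) (by simpa using hinj)

/-- The nonzero elements of `K[σ₁, σ₂, σ₃]`. -/
noncomputable def denom : Submonoid (R' K) where
  carrier := {w | w ∈ W' K ∧ w ≠ 0}
  one_mem' := ⟨one_mem _, fun h => one_ne_zero (polyMap_injective K (by simpa using h))⟩
  mul_mem' := by
    rintro a b ⟨ha, ha0⟩ ⟨hb, hb0⟩
    refine ⟨mul_mem ha hb, fun h => ?_⟩
    rw [W'_eq_range] at ha hb
    obtain ⟨p, rfl⟩ := ha
    obtain ⟨q, rfl⟩ := hb
    have : p * q = 0 := polyMap_injective K (by simpa using h)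
    rcases mul_eq_zero.1 this with rfl | rfl
    · exact ha0 (map_zero _)
    · exact hb0 (map_zero _)

instance instOreSetDenom : OreLocalization.OreSet (denom K) where
  ore_right_cancel r₁ r₂ s h := ⟨s, by
    rw [← W'_central K s.2.1 r₁, ← W'_central K s.2.1 r₂, h]⟩
  oreNum r _ := r
  oreDenom _ s := s
  ore_eq r s := (W'_central K s.2.1 r).symm

/-- The ring `R` of fractions `r / λ` with `r ∈ R'` and `0 ≠ λ ∈ K[σ₁, σ₂, σ₃]`. -/
abbrev R : Type _ := OreLocalization (denom K) (R' K)

/-- The canonical map `R' → R`, `r ↦ r / 1`. -/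
noncomputable def toR : R' K →+* R K := OreLocalization.numeratorRingHom

/-- The indeterminates in `R`. -/
noncomputable def x (i : Fin 3) : R K := toR K (x' K i)

/-- The field `W = K(σ₁, σ₂, σ₃)` inside `R`, as the set of all fractions `w / λ` with
`w, λ ∈ K[σ₁, σ₂, σ₃]`, `λ ≠ 0`. -/
def W : Set (R K) := {f | ∃ w ∈ W' K, ∃ l : denom K, f = w /ₒ l}

/-- The action on `R'` of the circular permutation `x₀ ↦ x₁ ↦ x₂ ↦ x₀`. -/
noncomputable def rot' : R' K →ₐ[K] R' K :=
  lift' K (fun i => x' K (i + 1)) fun i k => by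
    rw [elem_rotate (x' K) (x'_comm K)]
    exact x'_comm K _ k

theorem rot'_W' {w : R' K} (hw : w ∈ W' K) : rot' K w = w := by
  have : W' K ≤ AlgHom.equalizer (rot' K) (AlgHom.id K (R' K)) := by
    refine Algebra.adjoin_le ?_
    rintro _ ⟨k, rfl⟩
    exact (lift'_sigma' K _ _ k).trans (elem_rotate (x' K) (x'_comm K) k)
  exact this hw

/-- The action on `R` of the circular permutation `x₀ ↦ x₁ ↦ x₂ ↦ x₀`, the generator of the group
`G` of circular permutations: `r / λ ↦ rot' r / λ`. -/
noncomputable def rot : R K →+* R K :=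
  OreLocalization.universalHom ((toR K).comp (rot' K).toRingHom)
    { toFun := OreLocalization.numeratorUnit
      map_one' := by ext; exact map_one (toR K)
      map_mul' := fun a b => by ext; exact map_mul (toR K) (a : R' K) b }
    fun l => by
      change toR K (rot' K l) = toR K l
      rw [rot'_W' K l.2.1]

theorem rot_x (i : Fin 3) : rot K (x K i) = x K (i + 1) := by
  refine (OreLocalization.universalHom_commutes _ _ _).trans ?_
  exact congrArg (toR K) (lift'_x' K _ _ i)

theorem rot_oreDiv (r : R' K) (l : denom K) : rot K (r /ₒ l) = rot' K r /ₒ l := by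
  refine (OreLocalization.universalHom_apply _ _ _).trans ?_
  change ((1 : R' K) /ₒ l) * (rot' K r /ₒ (1 : denom K)) = _
  rw [OreLocalization.oreDiv_mul_char 1 (rot' K r) l 1 1 1 (by simp)]
  simp

/-- The generator acts with order dividing three, so `G = {1, rot, rot²}`. -/
theorem rot_rot_rot (p : R K) : rot K (rot K (rot K p)) = p := by
  have h (r : R' K) : rot' K (rot' K (rot' K r)) = r := by
    induction r using R'_induction with
    | hK a => simp
    | hx i =>
      simp only [rot', lift'_x']
      congr 1
      fin_cases i <;> rfl
    | hm a b h1 h2 => simp only [map_mul, h1, h2]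
    | ha a b h1 h2 => simp only [map_add, h1, h2]
  induction p using OreLocalization.ind with
  | _ r l => simp only [rot_oreDiv, h]

/-- The orbit polynomial of `p`: the sum of the `p ^ g` over the group `G` of circular
permutations. -/
noncomputable def orbitSum (p : R K) : R K := p + rot K p + rot K (rot K p)

/-- The fixed ring of `G` in `R`. -/
noncomputable def S : Subring (R K) := RingHom.eqLocus (rot K) (RingHom.id (R K))

/-- The commutator `c = [x₀, x₁]`, equal to `[x₁, x₂]` and to `[x₂, x₀]`. -/
noncomputable def c : R K := x K 0 * x K 1 - x K 1 * x K 0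

/-- The subring `Z = W[c³, orbit polynomial of x₀ x₁ x₀]` of `R`. -/
noncomputable def Z : Subring (R K) :=
  Subring.closure (W K ∪ {c K ^ 3, orbitSum K (x K 0 * x K 1 * x K 0)})

end NCElementary

/-! ### Identities for three elements of sum zero with central elementary polynomials -/

namespace NCElementary

/-! Subtracting σ₁/3 from each indeterminate gives y₀, y₁, y₂ of sum zero with central a, b such
that yᵢ³ + a yᵢ = b, and c is still their commutator. Two facts drive everything: c y₀ = y₂ c and
its rotations (`commutator_mul`), so c permutes the yᵢ cyclically and commutes with the orbit sum e
of y₀y₁y₀; and c³ is a quadratic polynomial in e over the scalars (`commutator_cube`). As the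
generator of Z given by the orbit sum differs from e by a scalar, Z is commutative and commutes with
c. Hence A = Z[c] is commutative, and equals Z + Zc + Zc² because c³ ∈ Z.

Spanning: R is the left A-span of 1, y₀, y₁, y₀², y₁² (`mem_combinations`), the decisive reduction
being that of y₀²y₁ (`three_mul_sq_mul`). G fixes A pointwise, and these five elements have orbit
sums 3, 0, 0, c - 2a, c - 2a, so every orbit sum lies in A (`orbitSum_mem`). An invariant element is
a third of its orbit sum, so S = A. The cubic equation is the characteristic polynomial of
multiplication by z₀ + z₁c + z₂c².

Independence: R is represented by 3 × 3 matrices over an algebraically closed field so that σ₁, σ₂,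
σ₃, e act as algebraically independent scalars and c as a diagonal matrix with distinct entries γ,
ω²γ, ωγ, ω a primitive cube root of unity (`exists_representation`). A relation over Z becomes a
Vandermonde system, which forces its coefficients to vanish. -/

/-- Three elements with sum zero whose elementary polynomials of degrees two and three are `a` and
`b`, both commuting with the three elements. -/
structure IsRootTriple {B : Type*} [Ring B] (y₀ y₁ y₂ a b : B) : Prop where
  sum : y₀ + y₁ + y₂ = 0
  mul₀₁ : y₀ * y₁ = y₂ * y₂ + a
  mul₁₂ : y₁ * y₂ = y₀ * y₀ + a
  mul₂₀ : y₂ * y₀ = y₁ * y₁ + a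
  prod : y₀ * y₁ * y₂ = b
  comm_a₀ : y₀ * a = a * y₀
  comm_a₁ : y₁ * a = a * y₁
  comm_b₀ : y₀ * b = b * y₀
  comm_b₁ : y₁ * b = b * y₁

namespace IsRootTriple

variable {B : Type*} [Ring B] {y₀ y₁ y₂ a b : B}

theorem eq₂ (h : IsRootTriple y₀ y₁ y₂ a b) : y₂ = -y₀ - y₁ := by
  have := h.sum
  rw [add_eq_zero_iff_neg_eq, neg_add] at this
  rw [← this, sub_eq_add_neg]

theorem comm_a₂ (h : IsRootTriple y₀ y₁ y₂ a b) : y₂ * a = a * y₂ := by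
  rw [h.eq₂, sub_mul, mul_sub, neg_mul, mul_neg, h.comm_a₀, h.comm_a₁]

theorem comm_b₂ (h : IsRootTriple y₀ y₁ y₂ a b) : y₂ * b = b * y₂ := by
  rw [h.eq₂, sub_mul, mul_sub, neg_mul, mul_neg, h.comm_b₀, h.comm_b₁]

theorem cube (h : IsRootTriple y₀ y₁ y₂ a b) : y₀ * (y₀ * y₀) = b - a * y₀ := by
  have := h.prod
  rw [mul_assoc, h.mul₁₂, mul_add, h.comm_a₀] at this
  rw [← this, add_sub_cancel_right]

/-- Makes every identity available for all three cyclic orderings. The only field that is not a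
reindexing is `prod`: y₁y₂y₀ = (y₀² + a)y₀, which is b by the cubic equation of y₀. -/
theorem rotate (h : IsRootTriple y₀ y₁ y₂ a b) : IsRootTriple y₁ y₂ y₀ a b where
  sum := by rw [← h.sum]; abel
  mul₀₁ := h.mul₁₂
  mul₁₂ := h.mul₂₀
  mul₂₀ := h.mul₀₁
  prod := by rw [h.mul₁₂, add_mul, mul_assoc, h.cube, sub_add_cancel]
  comm_a₀ := h.comm_a₁
  comm_a₁ := h.comm_a₂
  comm_b₀ := h.comm_b₁
  comm_b₁ := h.comm_b₂

theorem commutator_rotate (h : IsRootTriple y₀ y₁ y₂ a b) :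
    y₁ * y₂ - y₂ * y₁ = y₀ * y₁ - y₁ * y₀ := by
  rw [h.eq₂]; noncomm_ring

theorem mul_self₁ (h : IsRootTriple y₀ y₁ y₂ a b) :
    y₁ * y₁ = -(y₀ * y₀) - y₁ * y₀ - a := by
  have := h.mul₂₀
  rw [h.eq₂, sub_mul, neg_mul] at this
  rw [this]; abel

/-- This is y₂y₀y₁ = b with y₂ eliminated. Together with `cube` and `mul_self₁` it forms the
rewriting system for words in y₀, y₁ that is used below. -/
theorem mul_mul_mul (h : IsRootTriple y₀ y₁ y₂ a b) :
    y₁ * (y₀ * y₁) = -(y₀ * (y₀ * y₁)) - b := by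
  have := h.rotate.rotate.prod
  rw [h.eq₂] at this
  rw [← this]; noncomm_ring


/-- The commutator moves past y₀ at the cost of a cyclic shift of indices; with `rotate` this covers
all three elements. -/
theorem commutator_mul (h : IsRootTriple y₀ y₁ y₂ a b) :
    (y₀ * y₁ - y₁ * y₀) * y₀ = y₂ * (y₀ * y₁ - y₁ * y₀) := by
  have s2 (z : B) : y₁ * (y₁ * z) = (-(y₀ * y₀) - y₁ * y₀ - a) * z := by
    rw [← h.mul_self₁, mul_assoc]
  rw [h.eq₂]
  simp only [mul_assoc, mul_sub, sub_mul, neg_mul, s2, h.mul_mul_mul, h.cube]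
  abel

/-- Needed to reduce the word y₀y₀y₁ to terms of lower degree in the yᵢ with coefficients built from
a, the commutator and the cyclic sum on the left. -/
theorem three_mul_sq_mul (h : IsRootTriple y₀ y₁ y₂ a b) :
    3 * (y₀ * y₀ * y₁) = y₀ * y₁ * y₀ + y₁ * y₂ * y₁ + y₂ * y₀ * y₂
      + (y₀ * y₁ - y₁ * y₀) * (y₁ - y₂) + a * (y₀ - y₁) := by
  have n3 : (3 : B) = 1 + 1 + 1 := by norm_num
  rw [h.eq₂]
  simp only [n3, one_mul, mul_assoc, add_mul, mul_sub, sub_mul, neg_mul, mul_neg,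
    h.mul_self₁, h.mul_mul_mul, h.cube, h.comm_a₀]
  abel

/-- The sum of the cyclic conjugates of `y₀ y₁ y₀` commutes with the commutator. -/
theorem commutator_commute (h : IsRootTriple y₀ y₁ y₂ a b) :
    Commute (y₀ * y₁ - y₁ * y₀) (y₀ * y₁ * y₀ + y₁ * y₂ * y₁ + y₂ * y₀ * y₂) := by
  have c0 := h.commutator_mul
  have c1 := h.rotate.commutator_mul
  have c2 := h.rotate.rotate.commutator_mul
  rw [h.rotate.commutator_rotate, h.commutator_rotate] at c2
  rw [h.commutator_rotate] at c1
  generalize y₀ * y₁ - y₁ * y₀ = d at *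
  -- Passing the commutator through turns each word yᵢyⱼyᵢ into the word with both indices shifted,
  -- so the three summands are merely permuted.
  have m (p q p' q' : B) (hp : d * p = p' * d) (hq : d * q = q' * d) :
      d * (p * q * p) = p' * q' * p' * d := by
    rw [← mul_assoc, ← mul_assoc, hp, mul_assoc p', hq, mul_assoc, mul_assoc, hp]
    simp only [mul_assoc]
  rw [Commute, SemiconjBy, mul_add, mul_add, m _ _ _ _ c0 c1, m _ _ _ _ c1 c2, m _ _ _ _ c2 c0]
  noncomm_ring

theorem commutator_cube (h : IsRootTriple y₀ y₁ y₂ a b) :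
    (y₀ * y₁ - y₁ * y₀) ^ 3 = -((y₀ * y₁ * y₀ + y₁ * y₂ * y₁ + y₂ * y₀ * y₂) ^ 2
      + 3 * b * (y₀ * y₁ * y₀ + y₁ * y₂ * y₁ + y₂ * y₀ * y₂) + 9 * b ^ 2 + a ^ 3) := by
  have r1 := h.cube
  have r2 := h.mul_self₁
  have r3 := h.mul_mul_mul
  -- Each rule is also needed with a trailing factor, since products are kept right associated.
  have s1 (z : B) : y₀ * (y₀ * (y₀ * z)) = (b - a * y₀) * z := by rw [← r1]; simp only [mul_assoc]
  have s2 (z : B) : y₁ * (y₁ * z) = (-(y₀ * y₀) - y₁ * y₀ - a) * z := by rw [← r2, mul_assoc]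
  have s3 (z : B) : y₁ * (y₀ * (y₁ * z)) = (-(y₀ * (y₀ * y₁)) - b) * z := by
    rw [← r3]; simp only [mul_assoc]
  have a0 (z : B) : y₀ * (a * z) = a * (y₀ * z) := by rw [← mul_assoc, h.comm_a₀, mul_assoc]
  have a1 (z : B) : y₁ * (a * z) = a * (y₁ * z) := by rw [← mul_assoc, h.comm_a₁, mul_assoc]
  have b0 (z : B) : y₀ * (b * z) = b * (y₀ * z) := by rw [← mul_assoc, h.comm_b₀, mul_assoc]
  have b1 (z : B) : y₁ * (b * z) = b * (y₁ * z) := by rw [← mul_assoc, h.comm_b₁, mul_assoc]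
  have ba : b * a = a * b := by
    rw [← h.prod, mul_assoc, mul_assoc, h.comm_a₂, ← mul_assoc y₁, h.comm_a₁, mul_assoc, a0, ← mul_assoc y₀]
  have ba' (z : B) : b * (a * z) = a * (b * z) := by rw [← mul_assoc, ba, mul_assoc]
  have n3 : (3 : B) = 1 + 1 + 1 := by norm_num
  have n9 : (9 : B) = 1 + 1 + 1 + 1 + 1 + 1 + 1 + 1 + 1 := by norm_num
  rw [h.eq₂]
  simp only [n3, n9, pow_succ, pow_zero, one_mul, mul_assoc, mul_add, add_mul, mul_sub, sub_mul, neg_mul, mul_neg,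
    r1, r2, r3, s1, s2, s3, a0, a1, b0, b1, h.comm_a₀, h.comm_b₀, h.comm_b₁, ba, ba']
  abel

theorem map {C : Type*} [Ring C] (f : B →+* C) (h : IsRootTriple y₀ y₁ y₂ a b) :
    IsRootTriple (f y₀) (f y₁) (f y₂) (f a) (f b) where
  sum := by rw [← map_add, ← map_add, h.sum, map_zero]
  mul₀₁ := by rw [← map_mul, h.mul₀₁, map_add, map_mul]
  mul₁₂ := by rw [← map_mul, h.mul₁₂, map_add, map_mul]
  mul₂₀ := by rw [← map_mul, h.mul₂₀, map_add, map_mul]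
  prod := by rw [← map_mul, ← map_mul, h.prod]
  comm_a₀ := by rw [← map_mul, h.comm_a₀, map_mul]
  comm_a₁ := by rw [← map_mul, h.comm_a₁, map_mul]
  comm_b₀ := by rw [← map_mul, h.comm_b₀, map_mul]
  comm_b₁ := by rw [← map_mul, h.comm_b₁, map_mul]

end IsRootTriple

/-! ### Removing a third of the sum -/

section Shift

variable {B : Type*} [Ring B] {v : Fin 3 → B} {s : B}

/-- After the shift y₀(y₁ + y₂) = -y₀², while the second elementary polynomial of the shifted
elements is the old one minus 3s². -/
theorem sub_mul_sub_eq (hs : elem v 0 = s + s + s) (hc : ∀ i, v i * s = s * v i) :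
    (v 1 - s) * (v 2 - s) = (v 0 - s) * (v 0 - s) + (elem v 1 - 3 * s ^ 2) := by
  have e2 : v 2 = s + s + s - v 0 - v 1 := by
    rw [← hs]; simp [elem]; abel
  have n3 : (3 : B) = 1 + 1 + 1 := by norm_num
  simp only [elem, Matrix.cons_val_one, Matrix.cons_val_zero, e2, n3, pow_two, mul_add, add_mul,
    mul_sub, sub_mul, one_mul, hc]
  abel

/-- Subtracting a third of the sum from three elements whose elementary polynomials are central. -/
theorem isRootTriple_sub (h : ∀ i k, v i * elem v k = elem v k * v i)
    (hs : elem v 0 = s + s + s) (hc : ∀ i, v i * s = s * v i) :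
    IsRootTriple (v 0 - s) (v 1 - s) (v 2 - s) (elem v 1 - 3 * s ^ 2)
      (elem v 2 - s * (elem v 1 - 3 * s ^ 2) - s ^ 3) := by
  have h' (i k) : v (i + 1) * elem (fun i => v (i + 1)) k = elem (fun i => v (i + 1)) k * v (i + 1) := by
    rw [elem_rotate v h]; exact h _ _
  have ce (k) : Commute s (elem v k) := by
    have := fun i => (show Commute s (v i) from (hc i).symm)
    fin_cases k
    · exact ((this 0).add_right (this 1)).add_right (this 2)
    · exact (((this 0).mul_right (this 1)).add_right ((this 0).mul_right (this 2))).add_right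
        ((this 1).mul_right (this 2))
    · exact ((this 0).mul_right (this 1)).mul_right (this 2)
  have ca (i) : Commute (v i - s) (elem v 1 - 3 * s ^ 2) :=
    ((show Commute _ _ from h i 1).sub_left (ce 1)).sub_right
      (((Nat.cast_commute 3 _).symm).mul_right
        (((show Commute _ _ from hc i).sub_left (Commute.refl s)).pow_right 2))
  have cs (i) : Commute (v i - s) s := (show Commute _ _ from hc i).sub_left (Commute.refl s)
  have cb (i) : Commute (v i - s) (elem v 2 - s * (elem v 1 - 3 * s ^ 2) - s ^ 3) :=
    (((show Commute _ _ from h i 2).sub_left (ce 2)).sub_right ((cs i).mul_right (ca i))).sub_right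
      ((cs i).pow_right 3)
  refine ⟨?_, ?_, sub_mul_sub_eq hs hc, ?_, ?_, ca 0, ca 1, cb 0, cb 1⟩
  · have : v 0 + v 1 + v 2 = s + s + s := hs
    rw [← sub_eq_zero.2 this]; abel
  -- The remaining product formulas are the same identity for rotated families, which have the same
  -- elementary polynomials.
  · have := sub_mul_sub_eq (v := fun i => v (i + 1 + 1)) (s := s)
      (by rw [elem_rotate _ h', elem_rotate v h, hs]) fun i => hc _
    rwa [elem_rotate _ h', elem_rotate v h] at this
  · have := sub_mul_sub_eq (v := fun i => v (i + 1)) (s := s)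
      (by rw [elem_rotate v h, hs]) fun i => hc _
    rwa [elem_rotate v h] at this
  · have e2 : v 2 = s + s + s - v 0 - v 1 := by
      rw [← hs]; simp [elem]; abel
    have n3 : (3 : B) = 1 + 1 + 1 := by norm_num
    have hc' (i z) : v i * (s * z) = s * (v i * z) := by rw [← mul_assoc, hc, mul_assoc]
    simp only [elem, Matrix.cons_val_one, Matrix.cons_val_zero, Matrix.cons_val, e2, n3, pow_succ,
      pow_zero, mul_add, add_mul, mul_sub, sub_mul, one_mul, hc, hc', mul_assoc]
    abel

theorem commutator_sub (p q : B) (hp : Commute s p) (hq : Commute s q) :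
    (p - s) * (q - s) - (q - s) * (p - s) = p * q - q * p := by
  simp only [sub_mul, mul_sub, hp.eq, hq.eq]
  abel

/-- The terms quadratic in the yᵢ add up to s(y₀ + y₁ + y₂)² and the linear ones to 3s²(y₀ + y₁ +
y₂), so both vanish. -/
theorem cyclic_sum_add (y₀ y₁ y₂ : B) (h : y₀ + y₁ + y₂ = 0) (h₀ : y₀ * s = s * y₀)
    (h₁ : y₁ * s = s * y₁) :
    (y₀ + s) * (y₁ + s) * (y₀ + s) + (y₁ + s) * (y₂ + s) * (y₁ + s) +
      (y₂ + s) * (y₀ + s) * (y₂ + s) =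
    y₀ * y₁ * y₀ + y₁ * y₂ * y₁ + y₂ * y₀ * y₂ + 3 * s ^ 3 := by
  have e2 : y₂ = -y₀ - y₁ := by
    rw [add_eq_zero_iff_neg_eq, neg_add] at h
    rw [← h, sub_eq_add_neg]
  have n3 : (3 : B) = 1 + 1 + 1 := by norm_num
  have h₀' (z) : y₀ * (s * z) = s * (y₀ * z) := by rw [← mul_assoc, h₀, mul_assoc]
  have h₁' (z) : y₁ * (s * z) = s * (y₁ * z) := by rw [← mul_assoc, h₁, mul_assoc]
  simp only [e2, n3, pow_succ, pow_zero, mul_add, add_mul, mul_sub, sub_mul, one_mul, neg_mul,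
    mul_neg, h₀, h₁, h₀', h₁', mul_assoc]
  abel

end Shift
-- Centrality and invariance of the scalars in R
section Localization

variable {K : Type*} [Field K]

theorem toR_mul_oreDiv (r : R' K) (l : denom K) : toR K l * (r /ₒ l) = toR K r :=
  OreLocalization.mul_cancel (r := r) (s := l) (t := 1)

theorem isUnit_toR (l : denom K) : IsUnit (toR K l) :=
  OreLocalization.numerator_isUnit l

theorem toR_commute {w : R' K} (hw : w ∈ W' K) (p : R K) : Commute (toR K w) p := by
  induction p using OreLocalization.ind with
  | _ r l =>
    have h (r : R' K) : toR K r * toR K w = toR K w * toR K r := by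
      rw [← map_mul, W'_central K hw, map_mul]
    refine (isUnit_toR l).mul_left_cancel ?_
    rw [← mul_assoc, ← mul_assoc, h, mul_assoc, toR_mul_oreDiv, h]

theorem W_commute {f : R K} (hf : f ∈ W K) (p : R K) : Commute f p := by
  obtain ⟨w, hw, l, rfl⟩ := hf
  refine (isUnit_toR l).mul_left_cancel ?_
  rw [← mul_assoc, toR_mul_oreDiv, ← mul_assoc, (toR_commute l.2.1 p).eq, mul_assoc, toR_mul_oreDiv,
    (toR_commute hw p).eq]

theorem rot_eq_of_mem_W {f : R K} (hf : f ∈ W K) : rot K f = f := by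
  obtain ⟨w, hw, l, rfl⟩ := hf
  rw [rot_oreDiv, rot'_W' K hw]

theorem toR_mem_W {w : R' K} (hw : w ∈ W' K) : toR K w ∈ W K :=
  ⟨w, hw, 1, rfl⟩

/-- Polynomials in the elementary polynomials, as elements of `R`. -/
noncomputable def scalar (K : Type*) [Field K] : MvPolynomial (Fin 3) K →+* R K :=
  (toR K).comp (polyMap K).toRingHom

theorem polyMap_mem_W' (P : MvPolynomial (Fin 3) K) : polyMap K P ∈ W' K := by
  rw [W'_eq_range]; exact ⟨P, rfl⟩

theorem scalar_mem_W (P : MvPolynomial (Fin 3) K) : scalar K P ∈ W K :=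
  toR_mem_W (polyMap_mem_W' P)

theorem scalar_commute (P : MvPolynomial (Fin 3) K) (p : R K) : Commute (scalar K P) p :=
  W_commute (scalar_mem_W P) p

end Localization

/-! ### The shifted indeterminates in R -/

section Shift

open MvPolynomial

variable (K : Type*) [Field K]

/-- A third of `σ₁`. -/
noncomputable def shift : MvPolynomial (Fin 3) K := C 3⁻¹ * X 0

/-- The linear coefficient of the depressed cubic. -/
noncomputable def coeffA : MvPolynomial (Fin 3) K := X 1 - 3 * shift K ^ 2

/-- The negative of the constant coefficient of the depressed cubic. -/
noncomputable def coeffB : MvPolynomial (Fin 3) K := X 2 - shift K * coeffA K - shift K ^ 3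

/-- The indeterminates shifted to have sum zero. -/
noncomputable def y (i : Fin 3) : R K := x K i - scalar K (shift K)

variable {K}

theorem shift_add [CharZero K] : shift K + shift K + shift K = X 0 := by
  have : (C 3⁻¹ : MvPolynomial (Fin 3) K) * 3 = 1 := by
    rw [← map_ofNat (C (σ := Fin 3)) 3, ← C_mul, inv_mul_cancel₀ three_ne_zero, C_1]
  rw [shift]
  linear_combination X 0 * this

theorem elem_x (k : Fin 3) : elem (x K) k = scalar K (X k) := by
  rw [show scalar K (X k) = toR K (polyMap K (X k)) from rfl, polyMap_X, sigma']
  exact (map_elem (B := R K) (toR K) (x' K) k).symm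

theorem isRootTriple_y [CharZero K] :
    IsRootTriple (y K 0) (y K 1) (y K 2) (scalar K (coeffA K)) (scalar K (coeffB K)) := by
  have := isRootTriple_sub (v := x K) (s := scalar K (shift K))
    (fun i k => by rw [elem_x]; exact (scalar_commute _ _).eq.symm)
    (by rw [elem_x, ← map_add, ← map_add, shift_add]) fun i => (scalar_commute _ _).eq.symm
  rw [elem_x, elem_x] at this
  simpa only [y, coeffA, coeffB, map_sub, map_mul, map_pow, map_ofNat] using this

theorem rot_y (i : Fin 3) : rot K (y K i) = y K (i + 1) := by
  rw [y, map_sub, rot_x, rot_eq_of_mem_W (scalar_mem_W _), y]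

theorem c_eq : c K = y K 0 * y K 1 - y K 1 * y K 0 := 
  (commutator_sub (x K 0) (x K 1) (scalar_commute (shift K) _) (scalar_commute (shift K) _)).symm

theorem rot_c [CharZero K] : rot K (c K) = c K := by
  rw [c_eq, map_sub, map_mul, map_mul, rot_y, rot_y]
  exact isRootTriple_y.commutator_rotate

variable (K) in
/-- The orbit polynomial of `y₀ y₁ y₀`. -/
noncomputable def e : R K := y K 0 * y K 1 * y K 0 + y K 1 * y K 2 * y K 1 + y K 2 * y K 0 * y K 2

theorem rot_e : rot K (e K) = e K := by
  simp only [e, map_add, map_mul, rot_y]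
  simp only [Fin.reduceAdd, zero_add]
  abel

theorem orbitSum_eq [CharZero K] :
    orbitSum K (x K 0 * x K 1 * x K 0) = e K + scalar K (3 * shift K ^ 3) := by
  have hx (i) : x K i = y K i + scalar K (shift K) := (sub_add_cancel _ _).symm
  have h := fun i => (scalar_commute (shift K) (y K i)).eq.symm
  rw [e, map_mul, map_ofNat, map_pow, ← cyclic_sum_add _ _ _ isRootTriple_y.sum (h 0) (h 1)]
  simp only [orbitSum, map_mul, rot_x, ← hx]
  simp only [Fin.reduceAdd, zero_add]

theorem c_commute_e [CharZero K] : Commute (c K) (e K) := by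
  rw [c_eq]
  exact isRootTriple_y.commutator_commute

theorem c_cube [CharZero K] : c K ^ 3 = -(e K ^ 2 + scalar K (3 * coeffB K) * e K +
    scalar K (9 * coeffB K ^ 2 + coeffA K ^ 3)) := by
  rw [c_eq, isRootTriple_y.commutator_cube, ← e]
  simp only [map_add, map_mul, map_pow, map_ofNat, add_assoc]

end Shift

theorem add_add_self {B : Type*} [Ring B] (p : B) : p + p + p = 3 * p := by
  rw [← two_add_one_eq_three, add_mul, two_mul, one_mul]

/-! ### Adjoining a commuting element whose cube lies in a commutative subring -/

section CubicExtension

open scoped IsMulCommutative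

variable {B : Type*} [Ring B] (Q : Subring B) (d : B)

/-- The subring generated by a subring and one element. -/
abbrev adjoinElem : Subring B := Subring.closure (Q ∪ {d})

variable {Q d}

theorem le_adjoinElem : Q ≤ adjoinElem Q d :=
  fun _ h => Subring.subset_closure (Or.inl h)

theorem mem_adjoinElem : d ∈ adjoinElem Q d := Subring.subset_closure (Or.inr rfl)

theorem adjoinElem_comm (hQ : ∀ z ∈ Q, ∀ w ∈ Q, z * w = w * z) (hd : ∀ z ∈ Q, z * d = d * z) :
    ∀ p ∈ (Q ∪ {d} : Set B), ∀ q ∈ (Q ∪ {d} : Set B), p * q = q * p := by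
  rintro p (hp | rfl) q (hq | rfl)
  exacts [hQ p hp q hq, hd p hp, (hd q hq).symm, rfl]

theorem adjoinElem_mul_comm (hQ : ∀ z ∈ Q, ∀ w ∈ Q, z * w = w * z)
    (hd : ∀ z ∈ Q, z * d = d * z) {p q : B} (hp : p ∈ adjoinElem Q d) (hq : q ∈ adjoinElem Q d) :
    p * q = q * p := by
  have : IsMulCommutative (adjoinElem Q d) :=
    Subring.isMulCommutative_closure (adjoinElem_comm hQ hd)
  exact congrArg Subtype.val (mul_comm (⟨p, hp⟩ : adjoinElem Q d) ⟨q, hq⟩)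

theorem exists_of_mem_adjoinElem (hQ : ∀ z ∈ Q, ∀ w ∈ Q, z * w = w * z)
    (hd : ∀ z ∈ Q, z * d = d * z) (h3 : d ^ 3 ∈ Q) {p : B} (hp : p ∈ adjoinElem Q d) :
    ∃ z₀ ∈ Q, ∃ z₁ ∈ Q, ∃ z₂ ∈ Q, p = z₀ + z₁ * d + z₂ * d ^ 2 := by
  induction hp using Subring.closure_induction with
  | mem p hp =>
    rcases hp with hp | rfl
    · exact ⟨p, hp, 0, zero_mem _, 0, zero_mem _, by simp⟩
    · exact ⟨0, zero_mem _, 1, one_mem _, 0, zero_mem _, by simp⟩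
  | zero => exact ⟨0, zero_mem _, 0, zero_mem _, 0, zero_mem _, by simp⟩
  | one => exact ⟨1, one_mem _, 0, zero_mem _, 0, zero_mem _, by simp⟩
  | add p q _ _ hp hq =>
    obtain ⟨z₀, h₀, z₁, h₁, z₂, h₂, rfl⟩ := hp
    obtain ⟨w₀, k₀, w₁, k₁, w₂, k₂, rfl⟩ := hq
    exact ⟨_, add_mem h₀ k₀, _, add_mem h₁ k₁, _, add_mem h₂ k₂, by
      simp only [add_mul]; abel⟩
  | neg p _ hp =>
    obtain ⟨z₀, h₀, z₁, h₁, z₂, h₂, rfl⟩ := hp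
    exact ⟨_, neg_mem h₀, _, neg_mem h₁, _, neg_mem h₂, by simp only [neg_mul]; abel⟩
  | mul p q _ _ hp hq =>
    obtain ⟨z₀, h₀, z₁, h₁, z₂, h₂, rfl⟩ := hp
    obtain ⟨w₀, k₀, w₁, k₁, w₂, k₂, rfl⟩ := hq
    -- Multiplication modulo d³ ∈ Q: the terms in d³ and d⁴ fold back into those in 1 and d.
    refine ⟨z₀ * w₀ + (z₁ * w₂ + z₂ * w₁) * d ^ 3,
      add_mem (mul_mem h₀ k₀) (mul_mem (add_mem (mul_mem h₁ k₂) (mul_mem h₂ k₁)) h3),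
      z₀ * w₁ + z₁ * w₀ + z₂ * w₂ * d ^ 3,
      add_mem (add_mem (mul_mem h₀ k₁) (mul_mem h₁ k₀)) (mul_mem (mul_mem h₂ k₂) h3),
      z₀ * w₂ + z₁ * w₁ + z₂ * w₀,
      add_mem (add_mem (mul_mem h₀ k₂) (mul_mem h₁ k₁)) (mul_mem h₂ k₀), ?_⟩
    have : IsMulCommutative (adjoinElem Q d) :=
    Subring.isMulCommutative_closure (adjoinElem_comm hQ hd)
    have key (z₀ z₁ z₂ w₀ w₁ w₂ d : adjoinElem Q d) :
        (z₀ + z₁ * d + z₂ * d ^ 2) * (w₀ + w₁ * d + w₂ * d ^ 2) =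
          z₀ * w₀ + (z₁ * w₂ + z₂ * w₁) * d ^ 3 + (z₀ * w₁ + z₁ * w₀ + z₂ * w₂ * d ^ 3) * d +
            (z₀ * w₂ + z₁ * w₁ + z₂ * w₀) * d ^ 2 := by ring
    exact congrArg Subtype.val (key ⟨z₀, le_adjoinElem h₀⟩ ⟨z₁, le_adjoinElem h₁⟩
      ⟨z₂, le_adjoinElem h₂⟩ ⟨w₀, le_adjoinElem k₀⟩ ⟨w₁, le_adjoinElem k₁⟩ ⟨w₂, le_adjoinElem k₂⟩
      ⟨d, mem_adjoinElem⟩)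

/-- The characteristic polynomial of `z₀ + z₁ d + z₂ d²`. -/
theorem exists_cubic_of_mem_adjoinElem (hQ : ∀ z ∈ Q, ∀ w ∈ Q, z * w = w * z)
    (hd : ∀ z ∈ Q, z * d = d * z) (h3 : d ^ 3 ∈ Q) {p : B} (hp : p ∈ adjoinElem Q d) :
    ∃ a ∈ Q, ∃ b ∈ Q, ∃ f ∈ Q, p ^ 3 + a * p ^ 2 + b * p + f = 0 := by
  obtain ⟨z₀, h₀, z₁, h₁, z₂, h₂, rfl⟩ := exists_of_mem_adjoinElem hQ hd h3 hp
  -- Coefficients of the characteristic polynomial of multiplication on the basis 1, d, d², with d³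
  -- treated as a scalar; the constant term is minus the norm.
  refine ⟨-(3 * z₀), neg_mem (mul_mem (ofNat_mem Q 3) h₀),
    3 * z₀ ^ 2 - 3 * (z₁ * z₂ * d ^ 3), sub_mem (mul_mem (ofNat_mem Q 3) (pow_mem h₀ 2))
      (mul_mem (ofNat_mem Q 3) (mul_mem (mul_mem h₁ h₂) h3)),
    3 * (z₀ * (z₁ * z₂ * d ^ 3)) - z₀ ^ 3 - z₁ ^ 3 * d ^ 3 - z₂ ^ 3 * (d ^ 3) ^ 2,
    sub_mem (sub_mem (sub_mem (mul_mem (ofNat_mem Q 3) (mul_mem h₀ (mul_mem (mul_mem h₁ h₂) h3)))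
      (pow_mem h₀ 3)) (mul_mem (pow_mem h₁ 3) h3)) (mul_mem (pow_mem h₂ 3) (pow_mem h3 2)), ?_⟩
  have : IsMulCommutative (adjoinElem Q d) :=
    Subring.isMulCommutative_closure (adjoinElem_comm hQ hd)
  have key (z₀ z₁ z₂ d : adjoinElem Q d) :
      (z₀ + z₁ * d + z₂ * d ^ 2) ^ 3 + -(3 * z₀) * (z₀ + z₁ * d + z₂ * d ^ 2) ^ 2 +
        (3 * z₀ ^ 2 - 3 * (z₁ * z₂ * d ^ 3)) * (z₀ + z₁ * d + z₂ * d ^ 2) +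
        (3 * (z₀ * (z₁ * z₂ * d ^ 3)) - z₀ ^ 3 - z₁ ^ 3 * d ^ 3 - z₂ ^ 3 * (d ^ 3) ^ 2) = 0 := by
    ring
  exact congrArg Subtype.val (key ⟨z₀, le_adjoinElem h₀⟩ ⟨z₁, le_adjoinElem h₁⟩
    ⟨z₂, le_adjoinElem h₂⟩ ⟨d, mem_adjoinElem⟩)

end CubicExtension

/-! ### The left span of 1, y₀, y₁, y₀², y₁² and its cyclic sums -/

section Combinations

variable {B : Type*} [Ring B] {y₀ y₁ y₂ a b : B} {A : Subring B}

variable (A y₀ y₁) in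
/-- The combinations of `1, y₀, y₁, y₀², y₁²` with left coefficients in a subring. -/
def combinations : Submodule A B :=
  Submodule.span A {1, y₀, y₁, y₀ * y₀, y₁ * y₁}

theorem one_mem_combinations : 1 ∈ combinations y₀ y₁ A := Submodule.subset_span (by simp)
theorem mem_y₀ : y₀ ∈ combinations y₀ y₁ A := Submodule.subset_span (by simp)
theorem mem_y₁ : y₁ ∈ combinations y₀ y₁ A := Submodule.subset_span (by simp)
theorem mem_sq₀ : y₀ * y₀ ∈ combinations y₀ y₁ A := Submodule.subset_span (by simp)
theorem mem_sq₁ : y₁ * y₁ ∈ combinations y₀ y₁ A := Submodule.subset_span (by simp)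

theorem mul_mem_combinations {t n : B} (ht : t ∈ A) (hn : n ∈ combinations y₀ y₁ A) :
    t * n ∈ combinations y₀ y₁ A :=
  Submodule.smul_mem _ (⟨t, ht⟩ : A) hn

theorem mem_combinations_of_mem {t : B} (ht : t ∈ A) : t ∈ combinations y₀ y₁ A := by
  simpa using mul_mem_combinations ht one_mem_combinations

theorem IsRootTriple.mem_y₂ (h : IsRootTriple y₀ y₁ y₂ a b) : y₂ ∈ combinations y₀ y₁ A := by
  rw [h.eq₂]; exact sub_mem (neg_mem mem_y₀) mem_y₁

/-- Coefficients stand on the left and the yᵢ multiply on the right, so only the products of the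
five generators with y₀ and y₁ have to be reduced. -/
theorem IsRootTriple.mul_y_mem (h : IsRootTriple y₀ y₁ y₂ a b) {t : B} (ht : t ∈ A) (h3 : t * 3 = 1)
    (ha : a ∈ A) (hb : b ∈ A) (hc : y₀ * y₁ - y₁ * y₀ ∈ A)
    (he : y₀ * y₁ * y₀ + y₁ * y₂ * y₁ + y₂ * y₀ * y₂ ∈ A) {n : B} (hn : n ∈ combinations y₀ y₁ A) :
    n * y₀ ∈ combinations y₀ y₁ A ∧ n * y₁ ∈ combinations y₀ y₁ A := by
  have e10 : y₁ * y₀ = -(y₀ * y₀) - y₁ * y₁ - a := by rw [h.mul_self₁]; abel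
  have m10 : y₁ * y₀ ∈ combinations y₀ y₁ A := by
    rw [e10]
    exact sub_mem (sub_mem (neg_mem mem_sq₀) mem_sq₁) (mem_combinations_of_mem ha)
  have e001 : y₀ * y₀ * y₁ = t * (y₀ * y₁ * y₀ + y₁ * y₂ * y₁ + y₂ * y₀ * y₂
      + (y₀ * y₁ - y₁ * y₀) * (y₁ - y₂) + a * (y₀ - y₁)) := by
    rw [← h.three_mul_sq_mul, ← mul_assoc, h3, one_mul]
  have e112 : y₁ * y₁ * y₂ = t * (y₀ * y₁ * y₀ + y₁ * y₂ * y₁ + y₂ * y₀ * y₂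
      + (y₀ * y₁ - y₁ * y₀) * (y₂ - y₀) + a * (y₁ - y₂)) := by
    have := h.rotate.three_mul_sq_mul
    rw [h.commutator_rotate, add_assoc (y₁ * y₂ * y₁), add_comm (y₁ * y₂ * y₁), add_right_comm] at this
    have e : y₀ * y₁ * y₀ + y₁ * y₂ * y₁ + y₂ * y₀ * y₂ =
      y₂ * y₀ * y₂ + y₀ * y₁ * y₀ + y₁ * y₂ * y₁ := by abel
    rw [e, ← one_mul (y₁ * y₁ * y₂), ← h3, mul_assoc t, this]
    congr 1
    abel
  have m001 : y₀ * y₀ * y₁ ∈ combinations y₀ y₁ A := by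
    rw [e001]
    exact mul_mem_combinations ht (add_mem (add_mem (mem_combinations_of_mem he)
      (mul_mem_combinations hc (sub_mem mem_y₁ h.mem_y₂)))
      (mul_mem_combinations ha (sub_mem mem_y₀ mem_y₁)))
  have m112 : y₁ * y₁ * y₂ ∈ combinations y₀ y₁ A := by
    rw [e112]
    exact mul_mem_combinations ht (add_mem (add_mem (mem_combinations_of_mem he)
      (mul_mem_combinations hc (sub_mem h.mem_y₂ mem_y₀)))
      (mul_mem_combinations ha (sub_mem mem_y₁ h.mem_y₂)))
  have m000 : y₀ * y₀ * y₀ ∈ combinations y₀ y₁ A := by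
    rw [mul_assoc, h.cube]
    exact sub_mem (mem_combinations_of_mem hb) (mul_mem_combinations ha mem_y₀)
  have m111 : y₁ * y₁ * y₁ ∈ combinations y₀ y₁ A := by
    rw [mul_assoc, h.rotate.cube]
    exact sub_mem (mem_combinations_of_mem hb) (mul_mem_combinations ha mem_y₁)
  have m110 : y₁ * y₁ * y₀ ∈ combinations y₀ y₁ A := by
    -- From y₁²(y₀ + y₁ + y₂) = 0.
    have : y₁ * y₁ * y₀ = -(y₁ * y₁ * y₁) - y₁ * y₁ * y₂ := by
      rw [h.eq₂]; noncomm_ring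
    rw [this]
    exact sub_mem (neg_mem m111) m112
  have m01 : y₀ * y₁ ∈ combinations y₀ y₁ A := by
    rw [← sub_add_cancel (y₀ * y₁) (y₁ * y₀)]
    exact add_mem (mem_combinations_of_mem hc) m10
  induction hn using Submodule.span_induction with
  | mem n hn =>
    rcases hn with rfl | rfl | rfl | rfl | rfl
    · simpa using And.intro mem_y₀ mem_y₁
    exacts [⟨mem_sq₀, m01⟩, ⟨m10, mem_sq₁⟩, ⟨m000, m001⟩, ⟨m110, m111⟩]
  | zero => simp
  | add p q _ _ hp hq =>
    rw [add_mul, add_mul]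
    exact ⟨add_mem hp.1 hq.1, add_mem hp.2 hq.2⟩
  | smul t n _ hn =>
    rw [smul_mul_assoc, smul_mul_assoc]
    exact ⟨Submodule.smul_mem _ t hn.1, Submodule.smul_mem _ t hn.2⟩

theorem IsRootTriple.mul_y₂_mem (h : IsRootTriple y₀ y₁ y₂ a b) {n : B} {N : Submodule A B}
    (h₀ : n * y₀ ∈ N) (h₁ : n * y₁ ∈ N) : n * y₂ ∈ N := by
  rw [h.eq₂, mul_sub, mul_neg]
  exact sub_mem (neg_mem h₀) h₁

theorem IsRootTriple.cyclic_sum_mem (h : IsRootTriple y₀ y₁ y₂ a b) (ha : a ∈ A) (hc : y₀ * y₁ - y₁ * y₀ ∈ A)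
    (ρ : B →+* B) (hρ : ∀ t ∈ A, ρ t = t) (h₀ : ρ y₀ = y₁) (h₁ : ρ y₁ = y₂) (h₂ : ρ y₂ = y₀) {n : B}
    (hn : n ∈ combinations y₀ y₁ A) : n + ρ n + ρ (ρ n) ∈ A := by
  -- The sum of squares is the common cyclic sum of the generators y₀² and y₁².
  have hs : y₀ * y₀ + y₁ * y₁ + y₂ * y₂ ∈ A := by
    have : y₀ * y₀ + y₁ * y₁ + y₂ * y₂ = y₀ * y₁ - y₁ * y₀ - (a + a) := by
      rw [h.mul_self₁, ← sub_eq_of_eq_add h.mul₀₁]; abel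
    rw [this]
    exact sub_mem hc (add_mem ha ha)
  induction hn using Submodule.span_induction with
  | mem n hn =>
    rcases hn with rfl | rfl | rfl | rfl | rfl
    · simpa using add_mem (add_mem (one_mem A) (one_mem A)) (one_mem A)
    · rw [h₀, h₁, h.sum]; exact zero_mem _
    · rw [h₁, h₂, h.rotate.sum]; exact zero_mem _
    · rwa [map_mul, h₀, map_mul, h₁]
    · rwa [map_mul, h₁, map_mul, h₂, add_comm, ← add_assoc]
  | zero => simp
  | add p q _ _ hp hq =>
    have : p + q + ρ (p + q) + ρ (ρ (p + q)) =
        (p + ρ p + ρ (ρ p)) + (q + ρ q + ρ (ρ q)) := by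
      simp only [map_add]; abel
    rw [this]
    exact add_mem hp hq
  | smul t n _ hn =>
    have : t • n + ρ (t • n) + ρ (ρ (t • n)) = t * (n + ρ n + ρ (ρ n)) := by
      simp only [Subring.smul_def, smul_eq_mul, map_mul, hρ t t.2, mul_add]
    rw [this]
    exact mul_mem t.2 hn

end Combinations
-- The fixed ring equals Z[c]
section FixedRing

variable {K : Type*} [Field K]

theorem W_subset_Z : W K ⊆ Z K := fun _ h => Subring.subset_closure (Or.inl h)

theorem scalar_mem_Z (P : MvPolynomial (Fin 3) K) : scalar K P ∈ Z K :=
  W_subset_Z (scalar_mem_W P)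

theorem c_cube_mem_Z : c K ^ 3 ∈ Z K := Subring.subset_closure (Or.inr (Or.inl rfl))

theorem toR_algebraMap (k : K) :
    toR K (algebraMap K (R' K) k) = scalar K (MvPolynomial.C k) :=
  congrArg (toR K) ((polyMap K).commutes k).symm

variable [CharZero K]

theorem e_mem_Z : e K ∈ Z K := by
  have h : orbitSum K (x K 0 * x K 1 * x K 0) ∈ Z K :=
    Subring.subset_closure (Or.inr (Or.inr rfl))
  rw [orbitSum_eq] at h
  exact (add_mem_cancel_right (scalar_mem_Z _)).1 h

/-- Induction over `Z` with the generator `e`. -/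
theorem Z_le {T : Subring (R K)} (hW : W K ⊆ T) (hc : c K ^ 3 ∈ T) (he : e K ∈ T) : Z K ≤ T := by
  refine Subring.closure_le.2 ?_
  rintro p (hp | rfl | rfl)
  · exact hW hp
  · exact hc
  · rw [orbitSum_eq]
    exact add_mem he (hW (scalar_mem_W _))

theorem Z_commute_c {z : R K} (hz : z ∈ Z K) : z * c K = c K * z := by
  have : Z K ≤ Subring.centralizer {c K} := by
    refine Z_le (fun w hw => ?_) ?_ ?_
    · exact Subring.mem_centralizer_iff.2 fun g _ => (W_commute hw g).eq.symm
    · rintro g rfl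
      exact ((Commute.refl (c K)).pow_right 3).eq
    · rintro g rfl
      exact c_commute_e.eq
  exact ((Subring.mem_centralizer_iff.1 (this hz)) _ rfl).symm

theorem Z_commute {z w : R K} (hz : z ∈ Z K) (hw : w ∈ Z K) : z * w = w * z := by
  have h1 : Z K ≤ Subring.centralizer {e K} := by
    refine Z_le (fun w hw => ?_) ?_ ?_
    · exact Subring.mem_centralizer_iff.2 fun g _ => (W_commute hw g).eq.symm
    · rintro g rfl
      exact (c_commute_e.pow_left 3).eq.symm
    · rintro g rfl
      rfl
  have h2 : Z K ≤ Subring.centralizer (Z K) := by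
    refine Z_le (fun w hw => ?_) ?_ ?_
    · exact Subring.mem_centralizer_iff.2 fun g _ => (W_commute hw g).eq.symm
    · exact Subring.mem_centralizer_iff.2 fun g hg =>
        ((show Commute g (c K) from Z_commute_c hg).pow_right 3).eq
    · exact Subring.mem_centralizer_iff.2 fun g hg =>
        ((Subring.mem_centralizer_iff.1 (h1 hg)) _ rfl).symm
  exact (Subring.mem_centralizer_iff.1 (h2 hz) w hw).symm

theorem Z_le_S : Z K ≤ S K := by
  refine Z_le (fun w hw => rot_eq_of_mem_W hw) ?_ rot_e
  exact pow_mem (show c K ∈ S K from rot_c) 3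

theorem adjoinElem_le_S : adjoinElem (Z K) (c K) ≤ S K := by
  refine Subring.closure_le.2 ?_
  rintro p (hp | rfl)
  exacts [Z_le_S hp, rot_c]

variable (K) in
/-- The inverse of three. -/
noncomputable def third : R K := scalar K (MvPolynomial.C 3⁻¹)

theorem third_mul : third K * 3 = 1 := by
  rw [third, ← map_ofNat (scalar K) 3, ← map_mul, ← map_ofNat (MvPolynomial.C (σ := Fin 3)) 3,
    ← MvPolynomial.C_mul, inv_mul_cancel₀ three_ne_zero, map_one, map_one]

theorem mul_x_mem {n : R K} (hn : n ∈ combinations (y K 0) (y K 1) (adjoinElem (Z K) (c K)))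
    (i : Fin 3) : n * x K i ∈ combinations (y K 0) (y K 1) (adjoinElem (Z K) (c K)) := by
  have h := isRootTriple_y.mul_y_mem (A := adjoinElem (Z K) (c K))
    (le_adjoinElem (scalar_mem_Z _)) third_mul (le_adjoinElem (scalar_mem_Z _))
    (le_adjoinElem (scalar_mem_Z _)) (by rw [← c_eq]; exact mem_adjoinElem)
    (le_adjoinElem e_mem_Z) hn
  have hs : n * scalar K (shift K) ∈ combinations (y K 0) (y K 1) (adjoinElem (Z K) (c K)) := by
    rw [← (scalar_commute _ _).eq]
    exact mul_mem_combinations (le_adjoinElem (scalar_mem_Z _)) hn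
  have hx : x K i = y K i + scalar K (shift K) := (sub_add_cancel _ _).symm
  rw [hx, mul_add]
  refine add_mem ?_ hs
  fin_cases i
  · exact h.1
  · exact h.2
  · change n * y K 2 ∈ _
    exact isRootTriple_y.mul_y₂_mem h.1 h.2

theorem mem_combinations (p : R K) :
    p ∈ combinations (y K 0) (y K 1) (adjoinElem (Z K) (c K)) := by
  have h (r : R' K) : ∀ n ∈ combinations (y K 0) (y K 1) (adjoinElem (Z K) (c K)),
      n * toR K r ∈ combinations (y K 0) (y K 1) (adjoinElem (Z K) (c K)) := by
    induction r using R'_induction with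
    | hK a =>
      intro n hn
      rw [toR_algebraMap, ← (scalar_commute _ _).eq]
      exact mul_mem_combinations (le_adjoinElem (scalar_mem_Z _)) hn
    | hx i => exact fun n hn => mul_x_mem hn i
    | hm a b ha hb =>
      intro n hn
      rw [map_mul, ← mul_assoc]
      exact hb _ (ha n hn)
    | ha a b ha hb =>
      intro n hn
      rw [map_add, mul_add]
      exact add_mem (ha n hn) (hb n hn)
  induction p using OreLocalization.ind with
  | _ r l =>
    have hl : (1 /ₒ l : R K) ∈ Z K := W_subset_Z ⟨1, one_mem _, l, rfl⟩
    -- The denominator becomes a left coefficient from W, and the numerator acts on 1 from the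
    -- right.
    have e : r /ₒ l = (1 /ₒ l : R K) * (1 * toR K r) := by
      rw [one_mul]
      exact ((OreLocalization.mul_div_one (p := 1) (r := r) (s := l)).trans
        (by rw [one_mul])).symm
    rw [e]
    exact mul_mem_combinations (le_adjoinElem hl) (h r 1 one_mem_combinations)

theorem orbitSum_mem (p : R K) : orbitSum K p ∈ adjoinElem (Z K) (c K) :=
  isRootTriple_y.cyclic_sum_mem (le_adjoinElem (scalar_mem_Z _))
    (by rw [← c_eq]; exact mem_adjoinElem) (rot K) (fun _ ht => adjoinElem_le_S ht) (rot_y 0)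
    (rot_y 1) (rot_y 2) (mem_combinations p)

/-- Averaging over G: an invariant element is a third of its orbit sum. -/
theorem mem_adjoinElem_of_mem_S {p : R K} (hp : p ∈ S K) : p ∈ adjoinElem (Z K) (c K) := by
  have hp' : rot K p = p := hp
  have h := mul_mem (le_adjoinElem (d := c K) (scalar_mem_Z (MvPolynomial.C 3⁻¹)))
    (orbitSum_mem p)
  have e : orbitSum K p = 3 * p := by
    rw [orbitSum, hp', hp']
    exact add_add_self p
  rwa [e, ← mul_assoc, ← third, third_mul, one_mul] at h

end FixedRing
-- The matrix model
section Model

open Matrix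

variable {L : Type*} [Field L]

/-- Three matrices whose elementary polynomials are scalar, for `ω` a primitive cube root of
unity. -/
def modelY (ω t v₀ v₁ v₂ : L) (i : Fin 3) : Matrix (Fin 3) (Fin 3) L :=
  !![0, ω ^ (2 * i.val) * v₀, ω ^ i.val * t; ω ^ i.val, 0, ω ^ (2 * i.val) * v₁;
    ω ^ (2 * i.val) * v₂, ω ^ i.val, 0]

variable {ω t v₀ v₁ v₂ a b γ : L}

theorem modelY_sum (hω : ω ^ 2 + ω + 1 = 0) : elem (modelY ω t v₀ v₁ v₂) 0 = 0 := by
  have h3 : ω ^ 3 = 1 := by linear_combination (ω - 1) * hω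
  ext i j
  fin_cases i <;> fin_cases j <;> simp [elem, modelY] <;> grind

/-- The model is yᵢ = ωⁱu + ω²ⁱv, with u a weighted cyclic shift, u³ = t, and v a shift in the
opposite direction, v³ = v₀v₁v₂. The hypotheses on v₀, v₁, t v₂ are the diagonal entries of 3vu =
-(a + ωd), where d = diag(γ, ω²γ, ωγ) is the intended commutator. -/
theorem modelY_pairs [CharZero L] (hω : ω ^ 2 + ω + 1 = 0) (h₀ : 3 * v₀ = -(a + ω * γ))
    (h₁ : 3 * v₁ = -(a + γ)) (h₂ : 3 * (t * v₂) = -(a + ω ^ 2 * γ)) :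
    elem (modelY ω t v₀ v₁ v₂) 1 = a • 1 := by
  ext i j
  fin_cases i <;> fin_cases j <;> simp [elem, modelY] <;> grind

theorem modelY_prod [CharZero L] (hω : ω ^ 2 + ω + 1 = 0) (h₀ : 3 * v₀ = -(a + ω * γ))
    (h₁ : 3 * v₁ = -(a + γ)) (h₂ : 3 * (t * v₂) = -(a + ω ^ 2 * γ)) (hb : v₀ * v₁ * v₂ = b - t) :
    elem (modelY ω t v₀ v₁ v₂) 2 = b • 1 := by
  ext i j
  fin_cases i <;> fin_cases j <;> simp [elem, modelY] <;> grind

theorem modelY_commutator [CharZero L] (hω : ω ^ 2 + ω + 1 = 0) (h₀ : 3 * v₀ = -(a + ω * γ))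
    (h₁ : 3 * v₁ = -(a + γ)) (h₂ : 3 * (t * v₂) = -(a + ω ^ 2 * γ)) :
    modelY ω t v₀ v₁ v₂ 0 * modelY ω t v₀ v₁ v₂ 1 - modelY ω t v₀ v₁ v₂ 1 * modelY ω t v₀ v₁ v₂ 0 =
      diagonal ![γ, ω ^ 2 * γ, ω * γ] := by
  ext i j
  fin_cases i <;> fin_cases j <;> simp [modelY] <;> grind

theorem modelY_cyclic_sum (hω : ω ^ 2 + ω + 1 = 0) (hb : v₀ * v₁ * v₂ = b - t)
    (y : Fin 3 → Matrix (Fin 3) (Fin 3) L) (hy : y = modelY ω t v₀ v₁ v₂) :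
    y 0 * y 1 * y 0 + y 1 * y 2 * y 1 + y 2 * y 0 * y 2 = (3 * (ω * t + ω ^ 2 * (b - t))) • 1 := by
  subst hy
  ext i j
  fin_cases i <;> fin_cases j <;> simp [modelY] <;> grind

/-- The parameters of the matrix model with prescribed scalars `a`, `b` and `E`. -/
theorem exists_model_parameters [CharZero L] [IsAlgClosed L] (a b E : L)
    (hE : E ^ 2 + 3 * b * E + 9 * b ^ 2 ≠ 0) (hg : E ^ 2 + 3 * b * E + (9 * b ^ 2 + a ^ 3) ≠ 0) :
    ∃ ω t v₀ v₁ v₂ γ : L, ω ^ 2 + ω + 1 = 0 ∧ γ ≠ 0 ∧ 3 * v₀ = -(a + ω * γ) ∧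
      3 * v₁ = -(a + γ) ∧ 3 * (t * v₂) = -(a + ω ^ 2 * γ) ∧ v₀ * v₁ * v₂ = b - t ∧
      3 * (ω * t + ω ^ 2 * (b - t)) = E := by
  obtain ⟨r, hr⟩ := IsAlgClosed.exists_pow_nat_eq (-3 : L) two_pos
  -- The value of γ³ is forced by the formula for the cube of the commutator.
  obtain ⟨γ, hγ⟩ := IsAlgClosed.exists_pow_nat_eq
    (-(E ^ 2 + 3 * b * E + (9 * b ^ 2 + a ^ 3))) three_pos
  obtain ⟨ω, hω⟩ : ∃ ω : L, ω ^ 2 + ω + 1 = 0 :=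
    ⟨(r - 1) / 2, by field_simp; linear_combination hr⟩
  have hω' : ω - ω ^ 2 ≠ 0 := by
    intro h
    have h3 : (3 : L) = 0 := by
      linear_combination (ω ^ 2 - 3 * ω + 3) * hω - (ω - ω ^ 2) * h
    exact three_ne_zero h3
  have hγ0 : γ ≠ 0 := by
    rintro rfl
    rw [zero_pow three_ne_zero, eq_comm, neg_eq_zero] at hγ
    exact hg hγ
  obtain ⟨t, ht'⟩ : ∃ t : L, 3 * (ω * t + ω ^ 2 * (b - t)) = E :=
    ⟨(E - 3 * ω ^ 2 * b) / (3 * (ω - ω ^ 2)), by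
      linear_combination mul_div_cancel₀ (E - 3 * ω ^ 2 * b) (mul_ne_zero three_ne_zero hω')⟩
  have ht : t ≠ 0 := by
    rintro rfl
    apply hE
    rw [← ht']
    grind
  refine ⟨ω, t, -(a + ω * γ) / 3, -(a + γ) / 3, -(a + ω ^ 2 * γ) / (3 * t), γ, hω, hγ0,
    by field_simp, by field_simp, by field_simp, ?_, ht'⟩
  -- The claim amounts to 27t(b - t) = -(a³ + γ³). The choice of t makes the left side E² + 3bE +
  -- 9b², and the choice of γ does the same for the right side.
  rw [div_mul_div_comm, div_mul_div_comm, div_eq_iff (by simp [ht])]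
  have e : -(a + ω * γ) * -(a + γ) * -(a + ω ^ 2 * γ) = -(a ^ 3 + γ ^ 3) := by grind
  rw [e, hγ, ← ht']
  grind

end Model
-- Undoes the shift: from the sum-zero matrices it recovers matrices on which the elementary
-- polynomials take the prescribed scalar values σₖ.
theorem elem_add {B : Type*} [Ring B] (y : Fin 3 → B) (s : B) (h : ∀ i, Commute s (y i))
    (h₀ : elem y 0 = 0) :
    elem (fun i => y i + s) = ![s + s + s, elem y 1 + 3 * s ^ 2, elem y 2 + s * elem y 1 + s ^ 3] := by
  have e2 : y 2 = -y 0 - y 1 := by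
    have h₀ : y 0 + y 1 + y 2 = 0 := h₀
    rw [add_eq_zero_iff_neg_eq, neg_add] at h₀
    rw [← h₀, sub_eq_add_neg]
  have n3 : (3 : B) = 1 + 1 + 1 := by norm_num
  have hc (i) : y i * s = s * y i := (h i).eq.symm
  have hc' (i z) : y i * (s * z) = s * (y i * z) := by rw [← mul_assoc, hc, mul_assoc]
  funext k
  fin_cases k
  · simp [elem, e2]; abel
  · simp [elem, e2, n3, pow_two, mul_add, add_mul, mul_sub, hc]; abel
  · simp [elem, e2, pow_succ, mul_add, add_mul, mul_sub, hc, hc', mul_assoc]; abel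

open Polynomial

/-! ### Representing R by matrices -/

section Representation

variable (K : Type*) [Field K]

/-- Polynomials in `e` over the polynomials in the elementary polynomials, as elements of `R`. -/
noncomputable def evalE : (MvPolynomial (Fin 3) K)[X] →+* R K :=
  eval₂RingHom' (scalar K) (e K) fun _ => scalar_commute _ _

theorem evalE_C (P : MvPolynomial (Fin 3) K) : evalE K (C P) = scalar K P := eval₂_C _ _

theorem evalE_X : evalE K X = e K := eval₂_X _ _

/-- `c³` as a polynomial in `e`. -/
noncomputable def cubePoly : (MvPolynomial (Fin 3) K)[X] :=
  -(X ^ 2 + C (3 * coeffB K) * X + C (9 * coeffB K ^ 2 + coeffA K ^ 3))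

theorem evalE_cubePoly [CharZero K] : evalE K (cubePoly K) = c K ^ 3 := by
  rw [c_cube, cubePoly, map_neg, map_add, map_add, map_mul, map_pow, evalE_C, evalE_C, evalE_X]

theorem quadratic_ne_zero {A : Type*} [CommRing A] [Nontrivial A] (p q : A) :
    (X ^ 2 + C p * X + C q : A[X]) ≠ 0 := by
  intro h
  have := congrArg (fun f => coeff f 2) h
  simp at this

variable {K}

/-- The matrix model as a representation of `R'`. -/
theorem exists_representation_R' [CharZero K] {L : Type*} [Field L] [CharZero L] [Algebra K L]
    (j : MvPolynomial (Fin 3) K →ₐ[K] L) {ω t v₀ v₁ v₂ γ : L} (hω : ω ^ 2 + ω + 1 = 0)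
    (h₀ : 3 * v₀ = -(j (coeffA K) + ω * γ)) (h₁ : 3 * v₁ = -(j (coeffA K) + γ))
    (h₂ : 3 * (t * v₂) = -(j (coeffA K) + ω ^ 2 * γ)) (hb : v₀ * v₁ * v₂ = j (coeffB K) - t) :
    ∃ φ : R' K →ₐ[K] Matrix (Fin 3) (Fin 3) L,
      (∀ i, φ (x' K i) = modelY ω t v₀ v₁ v₂ i + algebraMap L _ (j (shift K))) ∧
      ∀ P, φ (polyMap K P) = algebraMap L _ (j P) := by
  let M := Matrix (Fin 3) (Fin 3) L
  let jM : MvPolynomial (Fin 3) K →ₐ[K] M := (IsScalarTower.toAlgHom K L M).comp j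
  let v : Fin 3 → M := fun i => modelY ω t v₀ v₁ v₂ i + jM (shift K)
  have hs (m : M) : Commute (jM (shift K)) m :=
    Algebra.commutes (j (shift K)) m
  have hA : elem (modelY ω t v₀ v₁ v₂) 1 = jM (coeffA K) :=
    (modelY_pairs hω h₀ h₁ h₂).trans (Algebra.algebraMap_eq_smul_one _).symm
  have hB : elem (modelY ω t v₀ v₁ v₂) 2 = jM (coeffB K) :=
    (modelY_prod hω h₀ h₁ h₂ hb).trans (Algebra.algebraMap_eq_smul_one _).symm
  have he (k) : elem v k = jM (MvPolynomial.X k) := by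
    rw [elem_add _ _ (fun i => hs _) (modelY_sum hω), hA, hB]
    fin_cases k
    · change jM _ + jM _ + jM _ = _
      rw [← map_add, ← map_add, shift_add]
      rfl
    · change jM _ + 3 * jM _ ^ 2 = jM (MvPolynomial.X 1)
      rw [coeffA, map_sub, map_mul, map_ofNat, map_pow, sub_add_cancel]
    · change jM _ + jM _ * jM _ + jM _ ^ 3 = jM (MvPolynomial.X 2)
      rw [coeffB, map_sub, map_sub, map_mul, map_pow, sub_right_comm, sub_add_cancel, sub_add_cancel]
  have h : ∀ i k, v i * elem v k = elem v k * v i := by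
    intro i k
    rw [he]
    exact (Algebra.commutes (j (MvPolynomial.X k)) (v i)).symm
  refine ⟨lift' K v h, fun i => lift'_x' K v h i, fun P => ?_⟩
  have : (lift' K v h).comp (polyMap K) = jM := by
    refine MvPolynomial.algHom_ext fun k => ?_
    rw [AlgHom.comp_apply, polyMap_X, lift'_sigma', he]
  exact DFunLike.congr_fun this P

theorem exists_denom {P : MvPolynomial (Fin 3) K} (hP : P ≠ 0) :
    ∃ l : denom K, (l : R' K) = polyMap K P :=
  ⟨⟨polyMap K P, polyMap_mem_W' P, by
    rwa [Ne, map_eq_zero_iff _ (polyMap_injective K)]⟩, rfl⟩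

theorem exists_of_denom (l : denom K) : ∃ P : MvPolynomial (Fin 3) K, P ≠ 0 ∧ polyMap K P = l := by
  obtain ⟨h, h0⟩ := l.2
  rw [W'_eq_range] at h
  obtain ⟨P, hP⟩ := h
  refine ⟨P, ?_, hP⟩
  rintro rfl
  exact h0 (by rw [← hP]; exact map_zero _)

/-- A representation of `R'` in which the polynomials in the elementary polynomials act
faithfully by scalars extends to `R`. -/
theorem exists_extension {L : Type*} [Field L] [Algebra K L]
    (j : MvPolynomial (Fin 3) K →ₐ[K] L) (hj : Function.Injective j)
    (φ : R' K →ₐ[K] Matrix (Fin 3) (Fin 3) L) (hφ : ∀ P, φ (polyMap K P) = algebraMap L _ (j P)) :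
    ∃ Φ : R K →+* Matrix (Fin 3) (Fin 3) L, ∀ r, Φ (toR K r) = φ r := by
  let f : denom K →* Matrix (Fin 3) (Fin 3) L := (φ : R' K →* _).comp (denom K).subtype
  have hf (l : denom K) : IsUnit (f l) := by
    obtain ⟨P, hP, hl⟩ := exists_of_denom l
    change IsUnit (φ l)
    rw [← hl, hφ]
    exact (IsUnit.mk0 _ ((map_ne_zero_iff _ hj).2 hP)).map _
  refine ⟨OreLocalization.universalHom φ.toRingHom (IsUnit.liftRight f hf) fun l => ?_, fun r => ?_⟩
  · exact (IsUnit.coe_liftRight f hf l).symm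
  · exact OreLocalization.universalHom_commutes _ _ _

theorem exists_representation_of_injective [CharZero K] {L : Type*} [Field L] [IsAlgClosed L]
    [CharZero L] [Algebra K L] (j : (MvPolynomial (Fin 3) K)[X] →ₐ[K] L)
    (hj : Function.Injective j) : ∃ (Φ : R K →+* Matrix (Fin 3) (Fin 3) L) (ω γ : L),
      ω ^ 2 + ω + 1 = 0 ∧ γ ≠ 0 ∧ Φ (c K) = Matrix.diagonal ![γ, ω ^ 2 * γ, ω * γ] ∧
      ∀ P, Φ (evalE K P) = algebraMap L _ (j P) := by
  let jC : MvPolynomial (Fin 3) K →ₐ[K] L := j.comp CAlgHom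
  have hjC : Function.Injective jC := hj.comp C_injective
  -- The image of the variable satisfies no monic quadratic over the scalars, which gives both
  -- nonvanishing conditions on the parameters.
  have hquad (p q : MvPolynomial (Fin 3) K) : j X ^ 2 + jC p * j X + jC q ≠ 0 := by
    have e : j X ^ 2 + jC p * j X + jC q = j (X ^ 2 + C p * X + C q) := by
      rw [map_add, map_add, map_mul, map_pow]; rfl
    rw [e]
    exact (map_ne_zero_iff _ hj).2 (quadratic_ne_zero p q)
  have h3 : jC (3 * coeffB K) = 3 * jC (coeffB K) := by rw [map_mul, map_ofNat]
  have h9 : jC (9 * coeffB K ^ 2) = 9 * jC (coeffB K) ^ 2 := by rw [map_mul, map_ofNat, map_pow]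
  have h9a : jC (9 * coeffB K ^ 2 + coeffA K ^ 3) =
      9 * jC (coeffB K) ^ 2 + jC (coeffA K) ^ 3 := by rw [map_add, h9, map_pow]
  obtain ⟨ω, t, v₀, v₁, v₂, γ, hω, hγ, h₀, h₁, h₂, hb, hE⟩ :=
    exists_model_parameters (jC (coeffA K)) (jC (coeffB K)) (j X)
      (by rw [← h3, ← h9]; exact hquad _ _) (by rw [← h3, ← h9a]; exact hquad _ _)
  obtain ⟨φ, hx, hP⟩ := exists_representation_R' jC hω h₀ h₁ h₂ hb
  obtain ⟨Φ, hΦ⟩ := exists_extension jC hjC φ hP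
  have hs (P) : Φ (scalar K P) = algebraMap L _ (jC P) := (hΦ _).trans (hP P)
  have hy (i) : Φ (y K i) = modelY ω t v₀ v₁ v₂ i := by
    rw [y, map_sub, hs, x, hΦ, hx, add_sub_cancel_right]
  refine ⟨Φ, ω, γ, hω, hγ, ?_, fun P => ?_⟩
  · rw [c_eq, map_sub, map_mul, map_mul, hy, hy]
    exact modelY_commutator hω h₀ h₁ h₂
  · have : Φ.comp (evalE K) = (algebraMap L (Matrix (Fin 3) (Fin 3) L)).comp (j : _ →+* L) := by
      refine Polynomial.ringHom_ext (fun P => ?_) ?_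
      · rw [RingHom.comp_apply, evalE_C, hs]; rfl
      · rw [RingHom.comp_apply, evalE_X, e]
        simp only [map_add, map_mul, hy]
        rw [modelY_cyclic_sum hω hb _ rfl, hE]
        exact (Algebra.algebraMap_eq_smul_one _).symm
    exact DFunLike.congr_fun this P

/-- A representation of `R` by matrices of size three in which the subring generated by
`e` over the polynomials in the elementary polynomials acts faithfully by scalars. -/
theorem exists_representation.{u} (K : Type u) [Field K] [CharZero K] : ∃ (L : Type u) (_ : Field L) (_ : CharZero L)
    (j : (MvPolynomial (Fin 3) K)[X] →+* L) (Φ : R K →+* Matrix (Fin 3) (Fin 3) L) (ω γ : L),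
    Function.Injective j ∧ ω ^ 2 + ω + 1 = 0 ∧ γ ≠ 0 ∧
      Φ (c K) = Matrix.diagonal ![γ, ω ^ 2 * γ, ω * γ] ∧
      ∀ P, Φ (evalE K P) = algebraMap L _ (j P) := by
  let F := (MvPolynomial (Fin 3) K)[X]
  let L := AlgebraicClosure (FractionRing F)
  let j : F →ₐ[K] L := IsScalarTower.toAlgHom K F L
  have hj : Function.Injective j := by
    have : Function.Injective (algebraMap F L) := by
      rw [IsScalarTower.algebraMap_eq F (FractionRing F) L]
      exact (algebraMap (FractionRing F) L).injective.comp (IsFractionRing.injective F _)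
    exact this
  have : CharZero L := charZero_of_injective_algebraMap (algebraMap K L).injective
  obtain ⟨Φ, ω, γ, h⟩ := exists_representation_of_injective j hj
  exact ⟨L, inferInstance, this, j, Φ, ω, γ, hj, h⟩

end Representation

open Polynomial

/-! ### Independence of 1, c, c² over Z -/

section Independence

variable {K : Type*} [Field K]

theorem isUnit_scalar {P : MvPolynomial (Fin 3) K} (hP : P ≠ 0) : IsUnit (scalar K P) := by
  obtain ⟨l, hl⟩ := exists_denom hP
  have := isUnit_toR l
  rwa [hl] at this

theorem mul_neg_eq_neg {B : Type*} [Ring B] {p q r : B} (h : p * q = r) : p * -q = -r := by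
  rw [mul_neg, h]

variable (K) in
/-- The elements of `R` that are polynomials in `e` up to a denominator. -/
noncomputable def evalEFractions : Subring (R K) where
  carrier := {z | ∃ Q : MvPolynomial (Fin 3) K, Q ≠ 0 ∧ ∃ P, scalar K Q * z = evalE K P}
  zero_mem' := ⟨1, one_ne_zero, 0, by rw [map_zero, mul_zero]⟩
  one_mem' := ⟨1, one_ne_zero, 1, by rw [map_one, map_one, mul_one]⟩
  add_mem' := by
    rintro z w ⟨Q, hQ, P, hP⟩ ⟨Q', hQ', P', hP'⟩
    refine ⟨Q * Q', mul_ne_zero hQ hQ', C Q' * P + C Q * P', ?_⟩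
    rw [map_add, map_mul (evalE K) (C Q'), map_mul (evalE K) (C Q), ← hP, ← hP', evalE_C, evalE_C,
      map_mul, mul_add, ← mul_assoc, ← mul_assoc, (scalar_commute Q' (scalar K Q)).eq]
  mul_mem' := by
    rintro z w ⟨Q, hQ, P, hP⟩ ⟨Q', hQ', P', hP'⟩
    refine ⟨Q * Q', mul_ne_zero hQ hQ', P * P', ?_⟩
    rw [map_mul, map_mul, ← hP, ← hP', mul_assoc, mul_assoc, ← mul_assoc _ z,
      (scalar_commute Q' z).eq, mul_assoc]
  neg_mem' := by
    rintro z ⟨Q, hQ, P, hP⟩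
    exact ⟨Q, hQ, -P, by rw [map_neg]; exact mul_neg_eq_neg hP⟩

variable [CharZero K]

/-- The generator c³ is itself a polynomial in e, so only denominators in the σₖ occur. -/
theorem Z_le_evalEFractions : Z K ≤ evalEFractions K := by
  refine Z_le ?_ ⟨1, one_ne_zero, cubePoly K, ?_⟩ ⟨1, one_ne_zero, X, ?_⟩
  · rintro _ ⟨w, hw, l, rfl⟩
    rw [W'_eq_range] at hw
    obtain ⟨P, rfl⟩ := hw
    obtain ⟨Q, hQ, hl⟩ := exists_of_denom l
    refine ⟨Q, hQ, C P, ?_⟩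
    rw [evalE_C]
    change toR K (polyMap K Q) * _ = toR K (polyMap K P)
    rw [hl]
    exact toR_mul_oreDiv _ _
  · rw [map_one, one_mul, evalE_cubePoly]
  · rw [map_one, one_mul, evalE_X]

/-- A vanishing combination of three powers of distinct scalars `γ`, `ω² γ`, `ω γ`. -/
theorem eq_zero_of_combinations {L : Type*} [Field L] [CharZero L] {ω γ m₀ m₁ m₂ : L}
    (hω : ω ^ 2 + ω + 1 = 0) (hγ : γ ≠ 0) (h₀ : m₀ + m₁ * γ + m₂ * γ ^ 2 = 0)
    (h₁ : m₀ + m₁ * (ω ^ 2 * γ) + m₂ * (ω ^ 2 * γ) ^ 2 = 0)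
    (h₂ : m₀ + m₁ * (ω * γ) + m₂ * (ω * γ) ^ 2 = 0) : m₀ = 0 ∧ m₁ = 0 ∧ m₂ = 0 := by
  have e₀ : 3 * m₀ = 0 := by grind
  have e₁ : (3 * γ) * m₁ = 0 := by grind
  have e₂ : (3 * γ ^ 2) * m₂ = 0 := by grind
  have h3 : (3 : L) ≠ 0 := three_ne_zero
  exact ⟨(mul_eq_zero.1 e₀).resolve_left h3, (mul_eq_zero.1 e₁).resolve_left (mul_ne_zero h3 hγ),
    (mul_eq_zero.1 e₂).resolve_left (mul_ne_zero h3 (pow_ne_zero 2 hγ))⟩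

theorem linear_independence {z₀ z₁ z₂ : R K} (h₀ : z₀ ∈ Z K) (h₁ : z₁ ∈ Z K) (h₂ : z₂ ∈ Z K)
    (h : z₀ + z₁ * c K + z₂ * c K ^ 2 = 0) : z₀ = 0 ∧ z₁ = 0 ∧ z₂ = 0 := by
  obtain ⟨L, _, _, j, Φ, ω, γ, hj, hω, hγ, hc, hΦ⟩ := exists_representation K
  -- If Qz is the value at e of a polynomial P, then z acts as the scalar P/Q. When this is zero,
  -- injectivity of `j` gives P = 0, hence Qz = 0, and z = 0 because Q is a unit in R.
  have key {z : R K} (hz : z ∈ Z K) : ∃ m : L, Φ z = algebraMap L _ m ∧ (m = 0 → z = 0) := by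
    obtain ⟨Q, hQ, P, hP⟩ := Z_le_evalEFractions hz
    have hQ' : j (C Q) ≠ 0 := by
      rw [map_ne_zero_iff _ hj]; exact C_ne_zero.2 hQ
    have e : algebraMap L (Matrix (Fin 3) (Fin 3) L) (j (C Q)) * Φ z = algebraMap L _ (j P) := by
      rw [← hΦ, ← hΦ, evalE_C, ← map_mul, hP]
    refine ⟨(j (C Q))⁻¹ * j P, ?_, fun h => ?_⟩
    · rw [map_mul, ← e, ← mul_assoc, ← map_mul, inv_mul_cancel₀ hQ', map_one, one_mul]
    · have hP0 : P = 0 := by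
        rwa [mul_eq_zero, or_iff_right (inv_ne_zero hQ'), map_eq_zero_iff _ hj] at h
      rw [hP0, map_zero] at hP
      exact (isUnit_scalar hQ).mul_right_eq_zero.1 hP
  obtain ⟨m₀, e₀, i₀⟩ := key h₀
  obtain ⟨m₁, e₁, i₁⟩ := key h₁
  obtain ⟨m₂, e₂, i₂⟩ := key h₂
  have hm := congrArg Φ h
  rw [map_add, map_add, map_mul, map_mul, map_pow, map_zero, e₀, e₁, e₂, hc] at hm
  have hd (i : Fin 3) := congrFun (congrFun hm i) i
  have d₀ := hd 0
  have d₁ := hd 1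
  have d₂ := hd 2
  simp [Matrix.algebraMap_eq_diagonal, Matrix.diagonal_pow] at d₀ d₁ d₂
  obtain ⟨r₀, r₁, r₂⟩ := eq_zero_of_combinations hω hγ d₀ d₁ d₂
  exact ⟨i₀ r₀, i₁ r₁, i₂ r₂⟩

end Independence
end NCElementary

open NCElementary in
theorem theorem3p4 (K : Type*) [Field K] [CharZero K] :
    -- every invariant element has the form `z₀ + z₁ c + z₂ c²`
    (∀ p ∈ S K, ∃ z₀ ∈ Z K, ∃ z₁ ∈ Z K, ∃ z₂ ∈ Z K, p = z₀ + z₁ * c K + z₂ * c K ^ 2) ∧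
    -- the fixed ring is commutative, contains `Z` and `c`, and `1, c, c²` is a basis of it over `Z`
    ((∀ p ∈ S K, ∀ q ∈ S K, p * q = q * p) ∧ Z K ≤ S K ∧ c K ∈ S K ∧
      (∀ z₀ ∈ Z K, ∀ z₁ ∈ Z K, ∀ z₂ ∈ Z K, z₀ + z₁ * c K + z₂ * c K ^ 2 = 0 →
        z₀ = 0 ∧ z₁ = 0 ∧ z₂ = 0)) ∧
    -- every orbit polynomial is central or a root of a monic cubic over `Z`
    (∀ p : R K, orbitSum K p ∈ Subring.center (R K) ∨
      ∃ a ∈ Z K, ∃ b ∈ Z K, ∃ d ∈ Z K,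
        orbitSum K p ^ 3 + a * orbitSum K p ^ 2 + b * orbitSum K p + d = 0) :=
  have hZ : ∀ z ∈ Z K, ∀ w ∈ Z K, z * w = w * z := fun _ hz _ hw => Z_commute hz hw
  have hc : ∀ z ∈ Z K, z * c K = c K * z := fun _ hz => Z_commute_c hz
  ⟨fun _ hp => exists_of_mem_adjoinElem hZ hc c_cube_mem_Z (mem_adjoinElem_of_mem_S hp),
    ⟨fun _ hp _ hq => adjoinElem_mul_comm hZ hc (mem_adjoinElem_of_mem_S hp)
      (mem_adjoinElem_of_mem_S hq), Z_le_S, rot_c,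
      fun _ h₀ _ h₁ _ h₂ h => linear_independence h₀ h₁ h₂ h⟩,
    -- The cubic alternative holds for every p, central orbit sums included.
    fun p => Or.inr (exists_cubic_of_mem_adjoinElem hZ hc c_cube_mem_Z (orbitSum_mem p))⟩
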